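/- Let $\mathcal T=\{T_n\}_{n\in\mathbb N}$ be a tiling of $\mathbb R^2$, that is, a countable family of closed connected subsets of $\mathbb R^2$ (the tiles) with $\bigcup_n T_n=\mathbb R^2$ and $\operatorname{Int}(T_i)\cap\operatorname{Int}(T_j)=\emptyset$ for $i\ne j$. A *vertex* is a point that belongs to three or more tiles; an *edge* is a connected component of a set $E_{i,j}=\{u\in T_i\cap T_j : u \text{ is not a vertex}\}$ with $i\neq j$ and $E_{i,j}\ne\emptyset$; a *face* is the interior of a tile. Assume that - $\mathcal T$ is locally finite; - each tile is homeomorphic to the closed unit disk; - each edge is homeomorphic to the interval $(0,1)$; - whenever two different tiles intersect, their intersection is the disjoint union of a finite set of vertices and edges. Let $\mathcal D_{\mathcal T}$ be the set of all vertices, edges and faces of $\mathcal T$, with the quotient topology induced by the surjection $q:\mathbb R^2\to\mathcal D_{\mathcal T}$ that sends each point to the vertex, edge or face in which it lies. The *connectedness graph* of a topological space $X$ is the graph with vertex set $X$ in which two distinct points $x,y$ are adjacent if and only if $\{x,y\}$ is connected. Then the connectedness graph of $\mathcal D_{\mathcal T}$ is planar. Here a graph $G=(V_G,E_G)$ is called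 *planar* if there is a function $\psi:V_G\cup E_G\to\mathscr P(\mathbb R^2)$ such that 1. $\psi(v)$ is a singleton for every $v\in V_G$; 2. $\psi(e)$ is homeomorphic to $(0,1)$ for every $e\in E_G$; 3. $\psi(x)\cap\psi(y)=\emptyset$ for any two different $x,y\in V_G\cup E_G$; 4. if $v$ and $w$ are the ends of the edge $e$, then $\overline{\psi(e)}=\psi(e)\cup\psi(v)\cup\psi(w)$. -/

import Mathlib

/-- The plane `ℝ²`. -/
abbrev Plane : Type := EuclideanSpace ℝ (Fin 2)

namespace PlaneTiling

/-- The points that lie in three or more members of the family `T`. -/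
def vertexPoints (T : ℕ → Set Plane) : Set Plane :=
  {u | ∃ i j k : ℕ, i ≠ j ∧ i ≠ k ∧ j ≠ k ∧ u ∈ T i ∧ u ∈ T j ∧ u ∈ T k}

/-- The vertices, each regarded as the singleton of a point of the plane. -/
def vertexCells (T : ℕ → Set Plane) : Set (Set Plane) :=
  {c | ∃ u ∈ vertexPoints T, c = {u}}

/-- The points of `T i ∩ T j` that are not vertices. -/
def commonPoints (T : ℕ → Set Plane) (i j : ℕ) : Set Plane :=
  {u | u ∈ T i ∩ T j ∧ u ∉ vertexPoints T}

/-- The edges: the connected components of the sets `commonPoints T i j` with `i ≠ j`. -/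
def edgeCells (T : ℕ → Set Plane) : Set (Set Plane) :=
  {c | ∃ i j : ℕ, i ≠ j ∧ ∃ u ∈ commonPoints T i j, c = connectedComponentIn (commonPoints T i j) u}

/-- The faces: the interiors of the tiles. -/
def faceCells (T : ℕ → Set Plane) : Set (Set Plane) :=
  {c | ∃ i : ℕ, c = interior (T i)}

end PlaneTiling

/-- A tiling of the plane: a countable family of closed connected sets that cover the plane and have
pairwise disjoint interiors, which is locally finite, whose members are closed topological disks,
whose edges are open topological arcs, and in which two different tiles that meet do so in
the disjoint union of a finite set of vertices and edges. -/
structure PlaneTiling where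
  tile : ℕ → Set Plane
  isClosed_tile : ∀ n, IsClosed (tile n)
  isConnected_tile : ∀ n, IsConnected (tile n)
  iUnion_tile : ⋃ n, tile n = Set.univ
  disjoint_interior : ∀ i j, i ≠ j → interior (tile i) ∩ interior (tile j) = ∅
  locallyFinite_tile : LocallyFinite tile
  tile_homeomorph_disk : ∀ n, Nonempty (tile n ≃ₜ Metric.closedBall (0 : Plane) 1)
  edge_homeomorph_interval :
    ∀ c ∈ PlaneTiling.edgeCells tile, Nonempty (c ≃ₜ Set.Ioo (0 : ℝ) 1)
  inter_eq_sUnion : ∀ i j, i ≠ j → (tile i ∩ tile j).Nonempty →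
    ∃ S : Set (Set Plane), S.Finite ∧
      S ⊆ PlaneTiling.vertexCells tile ∪ PlaneTiling.edgeCells tile ∧
      S.PairwiseDisjoint id ∧ tile i ∩ tile j = ⋃₀ S

namespace PlaneTiling

/-- The underlying set of the digital version of a tiling: its faces, edges and vertices. -/
def DigitalVersion (𝒯 : PlaneTiling) : Type :=
  {c : Set Plane // c ∈ faceCells 𝒯.tile ∪ edgeCells 𝒯.tile ∪ vertexCells 𝒯.tile}

theorem exists_cell (𝒯 : PlaneTiling) (x : Plane) : ∃ c : 𝒯.DigitalVersion, x ∈ c.1 := by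
  by_cases hv : x ∈ vertexPoints 𝒯.tile
  · exact ⟨⟨{x}, Or.inr ⟨x, hv, rfl⟩⟩, rfl⟩
  obtain ⟨n, hn⟩ : ∃ n, x ∈ 𝒯.tile n := by
    have h : x ∈ ⋃ n, 𝒯.tile n := by rw [𝒯.iUnion_tile]; trivial
    simpa using h
  by_cases he : ∃ m, n ≠ m ∧ x ∈ 𝒯.tile m
  · obtain ⟨m, hnm, hm⟩ := he
    have hx : x ∈ commonPoints 𝒯.tile n m := ⟨⟨hn, hm⟩, hv⟩
    exact ⟨⟨_, Or.inl (Or.inr ⟨n, m, hnm, x, hx, rfl⟩)⟩, mem_connectedComponentIn hx⟩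
  · push Not at he
    refine ⟨⟨interior (𝒯.tile n), Or.inl (Or.inl ⟨n, rfl⟩)⟩, ?_⟩
    change x ∈ interior (𝒯.tile n)
    rw [mem_interior_iff_mem_nhds]
    filter_upwards [𝒯.locallyFinite_tile.iInter_compl_mem_nhds 𝒯.isClosed_tile x] with y hy
    have h : y ∈ ⋃ k, 𝒯.tile k := by rw [𝒯.iUnion_tile]; trivial
    obtain ⟨k, hk⟩ := Set.mem_iUnion.1 h
    by_cases hkn : n = k
    · exact hkn ▸ hk
    · simp only [Set.mem_iInter, Set.mem_compl_iff] at hy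
      exact absurd hk (hy k (he k hkn))

/-- The map that sends a point of the plane to the vertex, edge or face in which it lies. (The
vertices, edges and faces of a tiling partition the plane, so this cell is unique.) -/
noncomputable def quotientMap (𝒯 : PlaneTiling) (x : Plane) : 𝒯.DigitalVersion :=
  (𝒯.exists_cell x).choose

/-- The digital version carries the quotient topology induced by `quotientMap`. -/
noncomputable instance (𝒯 : PlaneTiling) : TopologicalSpace 𝒯.DigitalVersion :=
  TopologicalSpace.coinduced 𝒯.quotientMap inferInstance

end PlaneTiling

/-- The connectedness graph of a topological space: its vertices are the points of the space, and
two distinct points `x`, `y` are adjacent if and only if `{x, y}` is connected. -/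
def connectednessGraph (X : Type*) [TopologicalSpace X] : SimpleGraph X where
  Adj x y := x ≠ y ∧ IsConnected ({x, y} : Set X)
  symm := ⟨fun x y h => ⟨h.1.symm, Set.pair_comm x y ▸ h.2⟩⟩
  loopless := ⟨fun _ h => h.1 rfl⟩

/-- A graph is planar if its vertices and edges can be assigned pairwise disjoint subsets of the
plane, to each vertex a singleton and to each edge an open arc whose closure adds exactly the points
of the two ends of the edge. -/
def IsPlanarGraph {V : Type*} (G : SimpleGraph V) : Prop :=
  ∃ ψ : V ⊕ G.edgeSet → Set Plane,
    (∀ v : V, ∃ p : Plane, ψ (Sum.inl v) = {p}) ∧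
    (∀ e : G.edgeSet, Nonempty (ψ (Sum.inr e) ≃ₜ Set.Ioo (0 : ℝ) 1)) ∧
    (∀ x y : V ⊕ G.edgeSet, x ≠ y → ψ x ∩ ψ y = ∅) ∧
    (∀ (e : G.edgeSet) (v w : V), (e : Sym2 V) = s(v, w) →
      closure (ψ (Sum.inr e)) = ψ (Sum.inr e) ∪ ψ (Sum.inl v) ∪ ψ (Sum.inl w))

/-!
The vertices, edges and faces of a tiling partition the plane, and the closure of each cell is a
union of cells. A set of cells is closed in the digital version when its union is closed in the
plane, so two cells are adjacent in the connectedness graph only if one of them lies in the closure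
of the other (`PlaneTiling.subset_closure_or_subset_closure_of_isPreconnected`).

The drawing puts a hub in every cell and, inside each cell `c`, disjoint arcs ("spokes") from its hub
to all points of `closure c \ c`; see `IsSpokeSystem`. Adjacent cells are joined by the spoke in the
larger cell that ends at the hub of the smaller one. Spokes in different cells cannot meet because
the cells are disjoint, and so the drawing is planar (`isPlanarGraph_of_isSpokeSystem`).

* In an edge, the hub is the midpoint and the spokes are the two halves. The limit points of an edge
  outside it are vertices, and two tiles have only finitely many common vertices; hence each end of
  the edge converges (`exists_tendsto_of_finite_limit_points`).
* In a face, the hub and the spokes are the images of the centre and the radii of the unit disk. This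
  needs that a homeomorphism from the disk to a tile maps the open disk into the interior of the
  tile, that is, invariance of domain in the plane (`apply_mem_interior_image_closedBall`). It is
  proved with continuous logarithms: an odd function on the circle has none, whereas every
  nonvanishing continuous function on the disk has one.
-/

open Set Filter Topology Metric
open scoped unitInterval

/-! ### Continuous logarithms and invariance of domain in the plane -/

/-- Homotopy invariance of the existence of a continuous logarithm. -/
theorem exists_continuous_log_of_homotopy {A : Type*} [TopologicalSpace A] {H : I × A → ℂ}
    (hH : Continuous H) (h0 : ∀ x, H x ≠ 0)
    (hlog : ∃ l : A → ℂ, Continuous l ∧ ∀ a, Complex.exp (l a) = H (0, a)) :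
    ∃ l : A → ℂ, Continuous l ∧ ∀ a, Complex.exp (l a) = H (1, a) := by
  obtain ⟨l, hl, hlH⟩ := hlog
  let H' : C(I × A, {z : ℂ // z ≠ 0}) := ⟨fun x => ⟨H x, h0 x⟩, by fun_prop⟩
  let L := Complex.isCoveringMap_exp.liftHomotopy H' ⟨l, hl⟩
    (fun a => Subtype.ext (hlH a).symm)
  refine ⟨fun a => L (1, a), by fun_prop, fun a => ?_⟩
  have := congr_fun (Complex.isCoveringMap_exp.liftHomotopy_lifts H' ⟨l, hl⟩
    (fun a => Subtype.ext (hlH a).symm)) (1, a)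
  exact congr_arg Subtype.val this

theorem exists_continuous_log_closedBall {E : Type*} [NormedAddCommGroup E] [NormedSpace ℝ E]
    {g : E → ℂ} (hg : ContinuousOn g (closedBall 0 1)) (h0 : ∀ z ∈ closedBall (0 : E) 1, g z ≠ 0) :
    ∃ l : closedBall (0 : E) 1 → ℂ, Continuous l ∧ ∀ z, Complex.exp (l z) = g z := by
  have hmem : ∀ x : I × closedBall (0 : E) 1, (x.1 : ℝ) • (x.2 : E) ∈ closedBall (0 : E) 1 := by
    rintro ⟨t, z, hz⟩
    simp only [mem_closedBall_zero_iff, norm_smul, Real.norm_eq_abs, abs_of_nonneg t.2.1] at hz ⊢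
    exact mul_le_one₀ t.2.2 (norm_nonneg _) hz
  have := exists_continuous_log_of_homotopy
    (H := fun x : I × closedBall (0 : E) 1 => g ((x.1 : ℝ) • (x.2 : E)))
    (hg.comp_continuous (by fun_prop) hmem) (fun x => h0 _ (hmem x))
    ⟨fun _ => Complex.log (g 0), continuous_const, fun a => by
      simpa using Complex.exp_log (h0 0 (by simp))⟩
  simpa using this

/-- Borsuk's theorem in its simplest form: an odd function on a sphere of dimension at least one
has no continuous logarithm. -/
theorem not_exists_continuous_log_of_odd {E : Type*} [NormedAddCommGroup E] [NormedSpace ℝ E]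
    (hE : 1 < Module.rank ℝ E) {F : sphere (0 : E) 1 → ℂ} (hF : ∀ z, F (-z) = -F z) :
    ¬ ∃ l : sphere (0 : E) 1 → ℂ, Continuous l ∧ ∀ z, Complex.exp (l z) = F z := by
  rintro ⟨l, hl, hlF⟩
  have : ConnectedSpace (sphere (0 : E) 1) :=
    isConnected_iff_connectedSpace.1 (isConnected_sphere hE 0 zero_le_one)
  have hd : Continuous fun z => (l (-z) - l z).im := by fun_prop
  have hodd : ∀ z, Complex.exp (l (-z) - l z) = -1 := fun z => by
    rw [Complex.exp_sub, hlF, hlF, hF, neg_div, div_self (hlF z ▸ Complex.exp_ne_zero _)]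
  -- The imaginary part of `l (-z) - l z` changes sign under `z ↦ -z`, so it vanishes somewhere.
  obtain ⟨z, hz⟩ : ∃ z, (l (-z) - l z).im = 0 := by
    obtain ⟨z₀⟩ := (inferInstance : Nonempty (sphere (0 : E) 1))
    rcases le_total (l (-z₀) - l z₀).im 0 with h | h
    · exact mem_range_of_exists_le_of_exists_ge hd ⟨z₀, h⟩
        ⟨-z₀, by simp only [neg_neg, Complex.sub_im] at h ⊢; linarith⟩
    · exact mem_range_of_exists_le_of_exists_ge hd
        ⟨-z₀, by simp only [neg_neg, Complex.sub_im] at h ⊢; linarith⟩ ⟨z₀, h⟩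
  have h1 := congr_arg Complex.re (hodd z)
  rw [Complex.exp_re, hz, Real.cos_zero, mul_one] at h1
  have := Real.exp_pos (l (-z) - l z).re
  simp only [Complex.neg_re, Complex.one_re] at h1
  linarith

/-- Invariance of domain in the plane, at the centre of a disk. If `w ∉ f '' closedBall 0 1` is
close to `f 0`, then `f - w` has a continuous logarithm on the ball. On the unit sphere, `f z - w`
deforms to `f z - f 0` and then, by injectivity, through `f (z / (1 + t)) - f (-t z / (1 + t))` to
the odd function `f (z / 2) - f (-z / 2)`, which has no continuous logarithm. -/
theorem apply_zero_mem_interior_image_closedBall {E : Type*} [NormedAddCommGroup E]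
    [NormedSpace ℝ E] [ProperSpace E] (hE : 1 < Module.rank ℝ E) {f : E → ℂ}
    (hf : ContinuousOn f (closedBall 0 1)) (hinj : InjOn f (closedBall 0 1)) :
    f 0 ∈ interior (f '' closedBall 0 1) := by
  have hS : ∀ z : sphere (0 : E) 1, ‖(z : E)‖ = 1 := fun z => by simp
  have hSB : ∀ z : sphere (0 : E) 1, (z : E) ∈ closedBall (0 : E) 1 := fun z => by simp
  have hmem : ∀ (c : ℝ), |c| ≤ 1 → ∀ z : sphere (0 : E) 1, c • (z : E) ∈ closedBall (0 : E) 1 :=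
    fun c hc z => by simpa [norm_smul] using hc
  have h0B : (0 : E) ∈ closedBall (0 : E) 1 := by simp
  have hfS : Continuous fun z : sphere (0 : E) 1 => f z := hf.comp_continuous (by fun_prop) hSB
  obtain ⟨m, hm, hmf⟩ : ∃ m > 0, ∀ z : sphere (0 : E) 1, m ≤ ‖f z - f 0‖ := by
    have : Nonempty (sphere (0 : E) 1) :=
      (isConnected_sphere hE 0 zero_le_one).nonempty.to_subtype
    obtain ⟨z₀, -, hz₀⟩ := isCompact_univ.exists_isMinOn univ_nonempty
      ((hfS.sub continuous_const).norm.continuousOn)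
    replace hz₀ := fun z => hz₀ (mem_univ z)
    refine ⟨‖f z₀ - f 0‖, ?_, hz₀⟩
    rw [gt_iff_lt, norm_pos_iff, sub_ne_zero]
    intro h
    have := hS z₀
    rw [hinj (hSB z₀) h0B h] at this
    simp at this
  rw [mem_interior_iff_mem_nhds]
  filter_upwards [ball_mem_nhds (f 0) hm] with w hw
  by_contra hwf
  obtain ⟨l, hl, hlw⟩ := exists_continuous_log_closedBall (g := fun z => f z - w)
    (hf.sub continuousOn_const) (fun z hz h => hwf ⟨z, hz, sub_eq_zero.1 h⟩)
  have log0 : ∃ l : sphere (0 : E) 1 → ℂ, Continuous l ∧ ∀ z, Complex.exp (l z) = f z - f 0 := by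
    have := exists_continuous_log_of_homotopy
      (H := fun x : I × sphere (0 : E) 1 => f x.2 - w + (x.1 : ℝ) * (w - f 0))
      ?_ ?_ ⟨fun z => l ⟨z, hSB z⟩, by fun_prop, fun z => by simp [hlw]⟩
    · simpa using this
    · exact ((hfS.comp continuous_snd).sub continuous_const).add (by fun_prop)
    · rintro ⟨t, z⟩ h
      have h1 : f z - f 0 = ((1 - t : ℝ) : ℂ) * (w - f 0) := by
        push_cast; linear_combination h
      have h2 := hmf z
      rw [h1, norm_mul, Complex.norm_real, Real.norm_eq_abs,
        abs_of_nonneg (sub_nonneg.2 t.2.2)] at h2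
      rw [mem_ball, dist_eq_norm] at hw
      nlinarith [t.2.1, norm_nonneg (w - f 0)]
  have habs : ∀ t : I, |(1 + t : ℝ)⁻¹| ≤ 1 ∧ |-(t * (1 + t : ℝ)⁻¹)| ≤ 1 := by
    intro t
    have ht0 := t.2.1
    have h1 : (1 + t : ℝ)⁻¹ ≤ 1 := inv_le_one_of_one_le₀ (by linarith)
    have h2 : 0 ≤ (1 + t : ℝ)⁻¹ := by positivity
    refine ⟨by rwa [abs_of_nonneg h2], ?_⟩
    rw [abs_neg, abs_of_nonneg (by positivity)]
    exact mul_le_one₀ t.2.2 h2 h1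
  have hne : ∀ t : I, (1 + t : ℝ) ≠ 0 := fun t => by have := t.2.1; positivity
  have hcont : Continuous fun x : I × sphere (0 : E) 1 => (1 + x.1 : ℝ)⁻¹ :=
    (by fun_prop : Continuous fun x : I × sphere (0 : E) 1 => (1 + x.1 : ℝ)).inv₀
      fun x => hne x.1
  refine not_exists_continuous_log_of_odd hE (F := fun z : sphere (0 : E) 1 =>
    f ((2⁻¹ : ℝ) • (z : E)) - f (-(2⁻¹ : ℝ) • (z : E))) (fun z => by simp) ?_
  have := exists_continuous_log_of_homotopy
    (H := fun x : I × sphere (0 : E) 1 =>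
      f ((1 + x.1 : ℝ)⁻¹ • (x.2 : E)) - f ((-(x.1 * (1 + x.1 : ℝ)⁻¹)) • (x.2 : E)))
    ?_ ?_ (by simpa using log0)
  · norm_num at this ⊢
    exact this
  · refine (hf.comp_continuous (hcont.smul (by fun_prop)) fun x => hmem _ (habs x.1).1 x.2).sub
      (hf.comp_continuous (Continuous.smul (Continuous.neg (Continuous.mul (by fun_prop) hcont))
        (by fun_prop)) fun x => hmem _ (habs x.1).2 x.2)
  · rintro ⟨t, z⟩ h
    have h1 := hinj (hmem _ (habs t).1 z) (hmem _ (habs t).2 z) (sub_eq_zero.1 h)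
    have hz : (z : E) ≠ 0 := fun h => by have := hS z; simp [h] at this
    have h2 : (1 + t : ℝ)⁻¹ = -(t * (1 + t : ℝ)⁻¹) := smul_left_injective ℝ hz h1
    have h3 : (1 + t : ℝ) * (1 + t : ℝ)⁻¹ = 1 := mul_inv_cancel₀ (hne t)
    have : (1 : ℝ) = 0 := by
      linear_combination -h3 + h2
    exact one_ne_zero this

theorem apply_mem_interior_image_closedBall {g : Plane → Plane}
    (hg : ContinuousOn g (closedBall 0 1)) (hinj : InjOn g (closedBall 0 1)) {y : Plane}
    (hy : ‖y‖ < 1) : g y ∈ interior (g '' closedBall 0 1) := by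
  let e := Complex.orthonormalBasisOneI.repr.symm
  have hr : 0 < 1 - ‖y‖ := by linarith
  have hmaps : MapsTo (fun z : Plane => y + (1 - ‖y‖) • z) (closedBall 0 1) (closedBall 0 1) := by
    intro z hz
    rw [mem_closedBall_zero_iff] at hz ⊢
    calc ‖y + (1 - ‖y‖) • z‖ ≤ ‖y‖ + ‖(1 - ‖y‖) • z‖ := norm_add_le _ _
      _ = ‖y‖ + (1 - ‖y‖) * ‖z‖ := by rw [norm_smul, Real.norm_of_nonneg hr.le]
      _ ≤ 1 := by nlinarith
  have key := apply_zero_mem_interior_image_closedBall (E := Plane)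
    (by simp [← Module.finrank_eq_rank])
    (f := fun z => e (g (y + (1 - ‖y‖) • z)))
    (e.continuous.comp_continuousOn (hg.comp (by fun_prop) hmaps))
    (fun a ha b hb hab => by
      have := hinj (hmaps ha) (hmaps hb) (e.injective hab)
      exact smul_right_injective _ hr.ne' (add_left_cancel this))
  have h2 : e (g y) ∈ interior (e '' (g '' closedBall 0 1)) := by
    refine interior_mono ?_ (by simpa using key)
    rintro _ ⟨z, hz, rfl⟩
    exact mem_image_of_mem _ (mem_image_of_mem _ (hmaps hz))
  have h3 : e '' interior (g '' closedBall 0 1) = interior (e '' (g '' closedBall 0 1)) :=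
    e.toHomeomorph.image_interior _
  rw [← h3] at h2
  exact (e.injective.mem_set_image).1 h2

/-! ### Spoke systems in disks and arcs -/

theorem nonempty_homeomorph_image_Ioo {X : Type*} [TopologicalSpace X] [T2Space X] {γ : ℝ → X}
    (hγ : ContinuousOn γ (Icc 0 1)) (hinj : InjOn γ (Icc 0 1)) :
    Nonempty (γ '' Ioo 0 1 ≃ₜ Ioo (0 : ℝ) 1) := by
  have hemb : IsClosedEmbedding ((Icc (0 : ℝ) 1).domRestrict γ) :=
    (continuousOn_iff_continuous_domRestrict.1 hγ).isClosedEmbedding hinj.injective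
  have hemb' : IsEmbedding fun t : Ioo (0 : ℝ) 1 => γ t :=
    hemb.isEmbedding.comp (IsEmbedding.inclusion Ioo_subset_Icc_self)
  refine ⟨(hemb'.toHomeomorph.trans (Homeomorph.setCongr ?_)).symm⟩
  rw [image_eq_range]

theorem closure_image_Ioo {X : Type*} [TopologicalSpace X] [T2Space X] {γ : ℝ → X}
    (hγ : ContinuousOn γ (Icc 0 1)) :
    closure (γ '' Ioo 0 1) = γ '' Ioo 0 1 ∪ {γ 0} ∪ {γ 1} := by
  have hIcc : γ '' Icc 0 1 = γ '' Ioo 0 1 ∪ {γ 0} ∪ {γ 1} := by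
    rw [← Ioo_union_both (zero_le_one' ℝ), image_union, image_pair, union_assoc]
    rfl
  rw [← hIcc]
  refine (closure_minimal (image_mono Ioo_subset_Icc_self)
    (isCompact_Icc.image_of_continuousOn hγ).isClosed).antisymm ?_
  rw [← closure_Ioo (zero_ne_one' ℝ)]
  exact ContinuousOn.image_closure (by rwa [closure_Ioo (zero_ne_one' ℝ)])

/-- A system of spokes for a set `c` with hub `p ∈ c`: to each point `x` of `closure c \ c` an arc
`γ x`, parametrized by `[0, 1]`, that runs from `p` to `x` and stays in `c` until it reaches `x`.
Spokes to different points meet only in `p`. -/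
structure IsSpokeSystem {X : Type*} [TopologicalSpace X] (c : Set X) (p : X) (γ : X → ℝ → X) :
    Prop where
  hub_mem : p ∈ c
  continuousOn : ∀ x ∈ closure c \ c, ContinuousOn (γ x) (Icc 0 1)
  injOn : ∀ x ∈ closure c \ c, InjOn (γ x) (Icc 0 1)
  apply_zero : ∀ x ∈ closure c \ c, γ x 0 = p
  apply_one : ∀ x ∈ closure c \ c, γ x 1 = x
  mapsTo : ∀ x ∈ closure c \ c, MapsTo (γ x) (Ioo 0 1) c
  pairwiseDisjoint : (closure c \ c).PairwiseDisjoint fun x => γ x '' Ioo 0 1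

theorem isSpokeSystem_singleton {X : Type*} [TopologicalSpace X] [T1Space X] (p : X)
    (γ : X → ℝ → X) : IsSpokeSystem {p} p γ := by
  constructor <;> simp

/-- The spokes of an open disk are the images of the radii. That the interior of a closed
topological disk contains the image of the open unit disk is invariance of domain. -/
theorem exists_isSpokeSystem_interior {g : Plane → Plane} (hg : ContinuousOn g (closedBall 0 1))
    (hinj : InjOn g (closedBall 0 1)) :
    ∃ p γ, IsSpokeSystem (interior (g '' closedBall 0 1)) p γ := by
  set T := g '' closedBall 0 1
  have hT : IsClosed T := ((isCompact_closedBall 0 1).image_of_continuousOn hg).isClosed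
  have hint : ∀ y : Plane, ‖y‖ < 1 → g y ∈ interior T := fun y hy =>
    apply_mem_interior_image_closedBall hg hinj hy
  have hrim : ∀ x ∈ closure (interior T) \ interior T, ∃ y : Plane, ‖y‖ = 1 ∧ g y = x := by
    rintro x ⟨hx, hx'⟩
    obtain ⟨y, hy, rfl⟩ := closure_minimal interior_subset hT hx
    exact ⟨y, le_antisymm (by simpa using hy) (not_lt.1 fun h => hx' (hint y h)), rfl⟩
  choose! y hy hyx using hrim
  have hnorm : ∀ x ∈ closure (interior T) \ interior T, ∀ t : ℝ, 0 ≤ t → ‖t • y x‖ = t :=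
    fun x hx t ht => by rw [norm_smul, hy x hx, mul_one, Real.norm_of_nonneg ht]
  have hmem : ∀ x ∈ closure (interior T) \ interior T,
      MapsTo (fun t : ℝ => t • y x) (Icc 0 1) (closedBall 0 1) := fun x hx t ht => by
    simpa [hnorm x hx t ht.1] using ht.2
  refine ⟨g 0, fun x t => g (t • y x), ⟨hint 0 (by simp), ?_, ?_, ?_, ?_, ?_, ?_⟩⟩
  · exact fun x hx => hg.comp (by fun_prop) (hmem x hx)
  · intro x hx s hs t ht hst
    have := congr_arg norm (hinj (hmem x hx hs) (hmem x hx ht) hst)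
    rwa [hnorm x hx s hs.1, hnorm x hx t ht.1] at this
  · simp
  · simpa using hyx
  · exact fun x hx t ht => hint _ (by rw [hnorm x hx t ht.1.le]; exact ht.2)
  · intro x hx x' hx' hne
    refine Set.disjoint_left.2 ?_
    rintro _ ⟨s, hs, rfl⟩ ⟨t, ht, hst⟩
    have h := hinj (hmem x' hx' (Ioo_subset_Icc_self ht)) (hmem x hx (Ioo_subset_Icc_self hs)) hst
    have hst' := congr_arg norm h
    dsimp only at h hst'
    rw [hnorm x hx s hs.1.le, hnorm x' hx' t ht.1.le] at hst'
    subst hst'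
    exact hne (by rw [← hyx x hx, ← hyx x' hx', smul_right_injective _ ht.1.ne' h])

/-- An end of a bounded open arc with only finitely many limit points outside itself converges to
one of them. The filter `l` stands for either end of the parameter interval. -/
theorem exists_tendsto_of_finite_limit_points {X : Type*} [MetricSpace X] {φ : ℝ → X} {K F : Set X}
    {l : Filter ℝ} [l.NeBot] (hl : ∀ s ∈ l, ∃ u ∈ l, u ⊆ s ∧ IsPreconnected u ∧ ContinuousOn φ u)
    (hK : IsCompact K) (hφK : ∀ᶠ t in l, φ t ∈ K) (hF : F.Finite)
    (hlim : ∀ x, MapClusterPt x l φ → x ∈ F) : ∃ v ∈ F, Tendsto φ l (𝓝 v) := by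
  obtain ⟨v, -, hv⟩ := hK.exists_mapClusterPt_of_frequently hφK.frequently
  refine ⟨v, hlim v hv, ?_⟩
  obtain ⟨r, hr, hrF⟩ : ∃ r > 0, ∀ x ∈ F, dist x v < r → x = v := by
    have h : (F \ {v})ᶜ ∈ 𝓝 v := (hF.sdiff.isClosed.isOpen_compl).mem_nhds (by simp)
    obtain ⟨r, hr, h⟩ := Metric.mem_nhds_iff.1 h
    refine ⟨r, hr, fun x hx hxr => ?_⟩
    by_contra hne
    exact h hxr ⟨hx, hne⟩
  rw [(nhds_basis_ball (x := v)).tendsto_right_iff]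
  intro ε hε
  by_contra hcon
  -- The arc comes close to `v` and leaves it again infinitely often, so it meets the sphere of
  -- radius `δ` about `v` infinitely often, and has a limit point on that sphere.
  obtain ⟨δ, hδ, hδr, hδε⟩ : ∃ δ > 0, δ < r ∧ δ < ε :=
    ⟨min r ε / 2, by positivity, by linarith [min_le_left r ε, lt_min hr hε],
      by linarith [min_le_right r ε, lt_min hr hε]⟩
  have hfar : ∃ᶠ t in l, δ ≤ dist (φ t) v := by
    intro h
    exact hcon (h.mono fun t ht => lt_trans (not_le.1 ht) hδε)
  have hnear : ∃ᶠ t in l, dist (φ t) v < δ := hv.frequently (ball_mem_nhds v hδ)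
  have hsphere : ∃ᶠ t in l, φ t ∈ sphere v δ := by
    intro h
    obtain ⟨u, hu, hsub, hpre, hcont⟩ := hl _ h
    obtain ⟨a, ha, hau⟩ := (hfar.and_eventually hu).exists
    obtain ⟨b, hb, hbu⟩ := (hnear.and_eventually hu).exists
    obtain ⟨t, ht, htδ⟩ := hpre.intermediate_value hbu hau
      (f := fun t => dist (φ t) v)
      ((continuous_id.dist continuous_const).comp_continuousOn hcont) ⟨hb.le, ha⟩
    exact hsub ht htδ
  obtain ⟨x, ⟨hxδ, -⟩, hx⟩ := ((hK.inter_left isClosed_sphere).exists_mapClusterPt_of_frequently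
    (hsphere.and_eventually hφK))
  have hxv := hrF x (hlim x hx) (by rw [mem_sphere.1 hxδ]; exact hδr)
  rw [mem_sphere, hxv, dist_self] at hxδ
  exact hδ.ne hxδ

/-- The closed arc that parametrizes a bounded open arc with finitely many limit points together
with its ends, which may coincide. -/
theorem exists_extension_Icc_of_homeomorph_Ioo {X : Type*} [MetricSpace X] {c : Set X}
    (e : c ≃ₜ Ioo (0 : ℝ) 1) (hc : IsCompact (closure c)) (hfin : (closure c \ c).Finite) :
    ∃ φ : ℝ → X, ContinuousOn φ (Icc 0 1) ∧ InjOn φ (Ioo 0 1) ∧ φ '' Ioo 0 1 = c ∧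
      φ 0 ∉ c ∧ φ 1 ∉ c := by
  have : Nonempty X := ⟨(e.symm ⟨1 / 2, by norm_num, by norm_num⟩).1⟩
  let φ : ℝ → X := fun t => if ht : t ∈ Ioo (0 : ℝ) 1 then (e.symm ⟨t, ht⟩ : X) else
    Classical.arbitrary X
  have hφ : ∀ t (ht : t ∈ Ioo (0 : ℝ) 1), φ t = e.symm ⟨t, ht⟩ := fun t ht => dif_pos ht
  have hcont : ContinuousOn φ (Ioo 0 1) := by
    rw [continuousOn_iff_continuous_domRestrict]
    have : (Ioo (0 : ℝ) 1).domRestrict φ = fun t => (e.symm t : X) := by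
      ext1 t; exact hφ t t.2
    rw [this]; fun_prop
  have hinj : InjOn φ (Ioo 0 1) := fun s hs t ht hst => by
    rw [hφ s hs, hφ t ht] at hst
    simpa using e.symm.injective (Subtype.ext hst)
  have himg : φ '' Ioo 0 1 = c := by
    ext x
    constructor
    · rintro ⟨t, ht, rfl⟩; rw [hφ t ht]; exact (e.symm _).2
    · exact fun hx => ⟨e ⟨x, hx⟩, (e _).2, by rw [hφ _ (e _).2]; simp⟩
  -- A limit point `x` of an end is not on the arc: points close to `x` have parameters close to
  -- that of `x`.
  have hlim : ∀ l : Filter ℝ, Ioo 0 1 ∈ l → (∀ s ∈ Ioo (0 : ℝ) 1, ∃ u ∈ 𝓝 s, uᶜ ∈ l) →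
      ∀ x, MapClusterPt x l φ → x ∈ closure c \ c := by
    intro l hl hl' x hx
    refine ⟨?_, fun hxc => ?_⟩
    · rw [mem_closure_iff_clusterPt]
      have : map φ l ≤ 𝓟 c := by
        rw [le_principal_iff, mem_map]
        exact mem_of_superset hl fun t ht => himg ▸ mem_image_of_mem φ ht
      exact ClusterPt.mono hx this
    · obtain ⟨u, hu, hul⟩ := hl' _ (e ⟨x, hxc⟩).2
      have h1 : (fun y : c => (e y : ℝ)) ⁻¹' u ∈ 𝓝 (⟨x, hxc⟩ : c) :=
        (by fun_prop : Continuous fun y : c => (e y : ℝ)).continuousAt hu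
      obtain ⟨w, hw, hwu⟩ := mem_nhds_induced (Subtype.val) (⟨x, hxc⟩ : c) _ |>.1 h1
      obtain ⟨t, htw, ht, htu⟩ := ((hx.frequently hw).and_eventually
        (inter_mem hl hul : ∀ᶠ t in l, t ∈ Ioo 0 1 ∧ t ∈ uᶜ)).exists
      have : (e (e.symm ⟨t, ht⟩) : ℝ) ∈ u := hwu (show ((e.symm ⟨t, ht⟩ : c) : X) ∈ w by
        rw [← hφ t ht]; exact htw)
      rw [e.apply_symm_apply] at this
      exact htu this
  have hφc : ∀ l : Filter ℝ, Ioo 0 1 ∈ l → ∀ᶠ t in l, φ t ∈ closure c := fun l hl =>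
    mem_of_superset hl fun t ht => subset_closure (himg ▸ mem_image_of_mem φ ht)
  have h0 : Ioo (0 : ℝ) 1 ∈ 𝓝[>] 0 := Ioo_mem_nhdsGT one_pos
  have h1 : Ioo (0 : ℝ) 1 ∈ 𝓝[<] 1 := Ioo_mem_nhdsLT one_pos
  obtain ⟨v₀, hv₀, ht₀⟩ := exists_tendsto_of_finite_limit_points (l := 𝓝[>] 0) (fun s hs => by
      obtain ⟨b, hb, hbs⟩ := (mem_nhdsGT_iff_exists_Ioo_subset).1 (inter_mem hs h0)
      exact ⟨Ioo 0 b, Ioo_mem_nhdsGT hb, fun t ht => (hbs ht).1, isPreconnected_Ioo,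
        hcont.mono fun t ht => (hbs ht).2⟩) hc (hφc _ h0) hfin
    (hlim _ h0 fun s hs => ⟨Ioi (s / 2), Ioi_mem_nhds (by linarith [hs.1]), by
      rw [compl_Ioi]; exact mem_of_superset (Ioo_mem_nhdsGT (half_pos hs.1)) fun t ht => ht.2.le⟩)
  obtain ⟨v₁, hv₁, ht₁⟩ := exists_tendsto_of_finite_limit_points (l := 𝓝[<] 1) (fun s hs => by
      obtain ⟨b, hb, hbs⟩ := (mem_nhdsLT_iff_exists_Ioo_subset).1 (inter_mem hs h1)
      exact ⟨Ioo b 1, Ioo_mem_nhdsLT hb, fun t ht => (hbs ht).1, isPreconnected_Ioo,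
        hcont.mono fun t ht => (hbs ht).2⟩) hc (hφc _ h1) hfin
    (hlim _ h1 fun s hs => ⟨Iio ((s + 1) / 2), Iio_mem_nhds (by linarith [hs.2]), by
      rw [compl_Iio]
      exact mem_of_superset (Ioo_mem_nhdsLT (by linarith [hs.2] : (s + 1) / 2 < 1))
        fun t ht => ht.1.le⟩)
  have hext : EqOn (extendFrom (Ioo 0 1) φ) φ (Ioo 0 1) := extendFrom_extends hcont
  refine ⟨extendFrom (Ioo 0 1) φ, continuousOn_Icc_extendFrom_Ioo hcont ht₀ ht₁,
    hinj.congr hext.symm, hext.image_eq.trans himg, ?_, ?_⟩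
  · rw [eq_lim_at_left_extendFrom_Ioo one_pos ht₀]; exact hv₀.2
  · rw [eq_lim_at_right_extendFrom_Ioo one_pos ht₁]; exact hv₁.2

/-- The hub of an open arc is its midpoint, and its spokes are its halves. -/
theorem exists_isSpokeSystem_of_homeomorph_Ioo {X : Type*} [MetricSpace X] {c : Set X}
    (e : c ≃ₜ Ioo (0 : ℝ) 1) (hc : IsCompact (closure c)) (hfin : (closure c \ c).Finite) :
    ∃ p γ, IsSpokeSystem c p γ := by
  classical
  obtain ⟨φ, hφ, hinj, himg, h0, h1⟩ := exists_extension_Icc_of_homeomorph_Ioo e hc hfin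
  have hmem : ∀ t ∈ Ioo (0 : ℝ) 1, φ t ∈ c := fun t ht => himg ▸ mem_image_of_mem φ ht
  have hends : ∀ x ∈ closure c \ c, x = φ 0 ∨ x = φ 1 := by
    rintro x ⟨hx, hxc⟩
    rw [← himg, closure_image_Ioo hφ, himg] at hx
    rcases hx with (hx | hx) | hx
    exacts [absurd hx hxc, Or.inl hx, Or.inr hx]
  -- An arc with coinciding ends has a single spoke, namely its second half.
  let s : X → ℝ := fun x => if x = φ 1 then 1 else -1
  have hs : ∀ x ∈ closure c \ c, (s x = 1 ∧ x = φ 1) ∨ (s x = -1 ∧ x = φ 0) := by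
    intro x hx
    by_cases h : x = φ 1
    · exact Or.inl ⟨if_pos h, h⟩
    · exact Or.inr ⟨if_neg h, (hends x hx).resolve_right h⟩
  have hIoo : ∀ x ∈ closure c \ c, ∀ t ∈ Ico (0 : ℝ) 1, (1 + s x * t) / 2 ∈ Ioo (0 : ℝ) 1 := by
    intro x hx t ht
    rcases hs x hx with ⟨h, -⟩ | ⟨h, -⟩ <;> rw [h] <;> constructor <;> linarith [ht.1, ht.2]
  have hone : ∀ x ∈ closure c \ c, φ ((1 + s x * 1) / 2) = x := by
    intro x hx
    rcases hs x hx with ⟨h, h'⟩ | ⟨h, h'⟩ <;> rw [h] <;> norm_num <;> exact h'.symm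
  refine ⟨φ (1 / 2), fun x t => φ ((1 + s x * t) / 2),
    ⟨hmem _ (by norm_num), ?_, ?_, ?_, hone, ?_, ?_⟩⟩
  · intro x hx
    refine hφ.comp (by fun_prop) fun t ht => ?_
    rcases hs x hx with ⟨h, -⟩ | ⟨h, -⟩ <;> rw [h] <;> constructor <;> linarith [ht.1, ht.2]
  · intro x hx t ht t' ht' htt'
    dsimp only at htt'
    have hs0 : s x ≠ 0 := by rcases hs x hx with ⟨h, -⟩ | ⟨h, -⟩ <;> rw [h] <;> norm_num
    rcases ht.2.eq_or_lt with rfl | h1t <;> rcases ht'.2.eq_or_lt with rfl | h1t'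
    · rfl
    · rw [hone x hx] at htt'
      exact absurd (htt' ▸ hmem _ (hIoo x hx t' ⟨ht'.1, h1t'⟩)) hx.2
    · rw [hone x hx] at htt'
      exact absurd (htt' ▸ hmem _ (hIoo x hx t ⟨ht.1, h1t⟩)) hx.2
    · have h := hinj (hIoo x hx t ⟨ht.1, h1t⟩) (hIoo x hx t' ⟨ht'.1, h1t'⟩) htt'
      exact mul_left_cancel₀ hs0 (by linarith)
  · intro x hx; norm_num
  · exact fun x hx t ht => hmem _ (hIoo x hx t (Ioo_subset_Ico_self ht))
  · intro x hx x' hx' hne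
    refine Set.disjoint_left.2 ?_
    rintro _ ⟨t, ht, rfl⟩ ⟨t', ht', htt'⟩
    have h := hinj (hIoo x' hx' t' (Ioo_subset_Ico_self ht'))
      (hIoo x hx t (Ioo_subset_Ico_self ht)) htt'
    rcases hs x hx with ⟨h1, h2⟩ | ⟨h1, h2⟩ <;> rcases hs x' hx' with ⟨h3, h4⟩ | ⟨h3, h4⟩
    · exact hne (h2.trans h4.symm)
    · rw [h1, h3] at h; linarith [ht.1, ht'.1]
    · rw [h1, h3] at h; linarith [ht.1, ht'.1]
    · exact hne (h2.trans h4.symm)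

/-! ### Drawing a graph along spokes -/

/-- A graph is planar if its vertices index disjoint sets with spoke systems such that, for any two
adjacent vertices, the hub of one lies in the closure of the set of the other: the vertices are drawn
as the hubs, and the edges as the spokes that join them. -/
theorem isPlanarGraph_of_isSpokeSystem {V : Type*} {G : SimpleGraph V} {c : V → Set Plane}
    (hc : ∀ v w, v ≠ w → Disjoint (c v) (c w)) {p : V → Plane} {γ : V → Plane → ℝ → Plane}
    (hγ : ∀ v, IsSpokeSystem (c v) (p v) (γ v))
    (hadj : ∀ v w, G.Adj v w → p w ∈ closure (c v) ∨ p v ∈ closure (c w)) :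
    IsPlanarGraph G := by
  have hp : ∀ v w, p v ∈ c w → v = w := fun v w h => by
    by_contra hne
    exact Set.disjoint_left.1 (hc v w hne) (hγ v).hub_mem h
  have hp_inj : Function.Injective p := fun v w h => hp v w (h ▸ (hγ w).hub_mem)
  have hor : ∀ e : G.edgeSet, ∃ x : V × V, (e : Sym2 V) = s(x.1, x.2) ∧
      p x.2 ∈ closure (c x.1) \ c x.1 := by
    rintro ⟨e, he⟩
    induction e with | _ v w
    have hvw : G.Adj v w := he
    rcases hadj v w hvw with h | h
    · exact ⟨(v, w), rfl, h, fun h' => hvw.ne (hp _ _ h').symm⟩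
    · exact ⟨(w, v), Sym2.eq_swap, h, fun h' => hvw.ne (hp _ _ h')⟩
  choose x hx hxc using hor
  let A : G.edgeSet → Set Plane := fun e => γ (x e).1 (p (x e).2) '' Ioo 0 1
  have hAc : ∀ e, A e ⊆ c (x e).1 := fun e =>
    image_subset_iff.2 ((hγ (x e).1).mapsTo _ (hxc e))
  have hAp : ∀ e v, p v ∉ A e := by
    intro e v h
    have hv := hp _ _ (hAc e h)
    obtain ⟨t, ht, h⟩ := h
    rw [hv, ← (hγ (x e).1).apply_zero _ (hxc e)] at h
    exact ht.1.ne' ((hγ (x e).1).injOn _ (hxc e) (Ioo_subset_Icc_self ht) (by simp) h)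
  have hAA : ∀ e e', e ≠ e' → Disjoint (A e) (A e') := by
    intro e e' hne
    by_cases h1 : (x e).1 = (x e').1
    · have h2 : p (x e).2 ≠ p (x e').2 := fun h2 =>
        hne (Subtype.ext (by rw [hx, hx, h1, hp_inj h2]))
      have := (hγ (x e).1).pairwiseDisjoint (hxc e) (h1 ▸ hxc e') h2
      dsimp only [A]
      rw [← h1]
      exact this
    · exact (hc _ _ h1).mono (hAc e) (hAc e')
  refine ⟨Sum.elim (fun v => {p v}) A, fun v => ⟨p v, rfl⟩, fun e =>
    nonempty_homeomorph_image_Ioo ((hγ (x e).1).continuousOn _ (hxc e))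
      ((hγ (x e).1).injOn _ (hxc e)), ?_, ?_⟩
  · rintro (v | e) (w | e') hne
    · exact singleton_inter_eq_empty.2 fun h => hne (by rw [hp_inj h])
    · exact singleton_inter_eq_empty.2 (hAp e' v)
    · exact inter_singleton_eq_empty.2 (hAp e w)
    · exact (hAA e e' fun h => hne (by rw [h])).inter_eq
  · intro e v w he
    have hcl : closure (A e) = A e ∪ {p (x e).1} ∪ {p (x e).2} := by
      have := closure_image_Ioo ((hγ (x e).1).continuousOn _ (hxc e))
      rwa [(hγ (x e).1).apply_zero _ (hxc e), (hγ (x e).1).apply_one _ (hxc e)] at this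
    rw [hx e, Sym2.eq_iff] at he
    simp only [Sum.elim_inl, Sum.elim_inr]
    rcases he with ⟨h1, h2⟩ | ⟨h1, h2⟩
    · rw [hcl, h1, h2]
    · rw [hcl, h1, h2, union_right_comm]

/-! ### The cells of a tiling -/

namespace PlaneTiling

variable (𝒯 : PlaneTiling)

theorem exists_parametrization_tile (n : ℕ) : ∃ g : Plane → Plane,
    ContinuousOn g (closedBall 0 1) ∧ InjOn g (closedBall 0 1) ∧
      g '' closedBall 0 1 = 𝒯.tile n := by
  obtain ⟨e⟩ := 𝒯.tile_homeomorph_disk n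
  have h : ∃ g : Plane → Plane, ∀ y : closedBall (0 : Plane) 1, g y = e.symm y :=
    ⟨Function.extend Subtype.val (fun y => (e.symm y : Plane)) 0,
      fun y => Subtype.val_injective.extend_apply _ _ _⟩
  obtain ⟨g, hg⟩ := h
  refine ⟨g, ?_, ?_, ?_⟩
  · rw [continuousOn_iff_continuous_domRestrict]
    have : (closedBall 0 1).domRestrict g = fun y => (e.symm y : Plane) := funext hg
    rw [this]; fun_prop
  · intro y hy z hz hyz
    have h1 := hg ⟨y, hy⟩
    have h2 := hg ⟨z, hz⟩
    have h3 : e.symm ⟨y, hy⟩ = e.symm ⟨z, hz⟩ := Subtype.ext (h1.symm.trans (hyz.trans h2))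
    simpa using e.symm.injective h3
  · ext x
    constructor
    · rintro ⟨y, hy, rfl⟩
      rw [hg ⟨y, hy⟩]; exact (e.symm _).2
    · exact fun hx => ⟨e ⟨x, hx⟩, (e _).2, by rw [hg]; simp⟩

theorem isCompact_tile (n : ℕ) : IsCompact (𝒯.tile n) := by
  obtain ⟨g, hg, -, hgT⟩ := 𝒯.exists_parametrization_tile n
  exact hgT ▸ (isCompact_closedBall 0 1).image_of_continuousOn hg

/-- By invariance of domain the image of the open disk is interior to the tile, and it is dense. -/
theorem closure_interior_tile (n : ℕ) : closure (interior (𝒯.tile n)) = 𝒯.tile n := by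
  refine (closure_minimal interior_subset (𝒯.isClosed_tile n)).antisymm ?_
  obtain ⟨g, hg, hinj, hgT⟩ := 𝒯.exists_parametrization_tile n
  have hball : closure (ball (0 : Plane) 1) = closedBall 0 1 := closure_ball 0 one_ne_zero
  calc 𝒯.tile n = g '' closure (ball 0 1) := by rw [hball, hgT]
    _ ⊆ closure (g '' ball 0 1) := ContinuousOn.image_closure (by rwa [hball])
    _ ⊆ closure (interior (𝒯.tile n)) := by
      refine closure_mono (image_subset_iff.2 fun y hy => ?_)
      rw [mem_preimage, ← hgT]
      exact apply_mem_interior_image_closedBall hg hinj (by simpa using hy)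

theorem disjoint_interior_tile {i j : ℕ} (hij : i ≠ j) :
    Disjoint (interior (𝒯.tile i)) (𝒯.tile j) := by
  rw [← 𝒯.closure_interior_tile j]
  exact (disjoint_iff_inter_eq_empty.2 (𝒯.disjoint_interior i j hij)).closure_right
    isOpen_interior

variable {𝒯}

theorem eq_of_mem_interior_of_mem_tile {i j : ℕ} {x : Plane} (hi : x ∈ interior (𝒯.tile i))
    (hj : x ∈ 𝒯.tile j) : i = j := by
  by_contra h
  exact Set.disjoint_left.1 (𝒯.disjoint_interior_tile h) hi hj

theorem notMem_vertexPoints_of_mem_interior {i : ℕ} {x : Plane}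
    (hi : x ∈ interior (𝒯.tile i)) : x ∉ vertexPoints 𝒯.tile := by
  rintro ⟨j, k, l, hjk, -, -, hj, hk, -⟩
  exact hjk ((eq_of_mem_interior_of_mem_tile hi hj).symm.trans
    (eq_of_mem_interior_of_mem_tile hi hk))

theorem commonPoints_comm (T : ℕ → Set Plane) (i j : ℕ) :
    commonPoints T i j = commonPoints T j i := by
  simp only [commonPoints, inter_comm]

theorem eq_or_eq_of_mem_commonPoints {T : ℕ → Set Plane} {i j k : ℕ} (hij : i ≠ j) {x : Plane}
    (hx : x ∈ commonPoints T i j) (hk : x ∈ T k) : k = i ∨ k = j := by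
  by_contra! h
  exact hx.2 ⟨i, j, k, hij, h.1.symm, h.2.symm, hx.1.1, hx.1.2, hk⟩

theorem commonPoints_eq_of_mem {T : ℕ → Set Plane} {i j k l : ℕ} (hij : i ≠ j) (hkl : k ≠ l)
    {x : Plane} (hx : x ∈ commonPoints T i j) (hx' : x ∈ commonPoints T k l) :
    commonPoints T i j = commonPoints T k l := by
  rcases eq_or_eq_of_mem_commonPoints hij hx hx'.1.1 with rfl | rfl <;>
    rcases eq_or_eq_of_mem_commonPoints hij hx hx'.1.2 with rfl | rfl
  · exact absurd rfl hkl
  · rfl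
  · exact commonPoints_comm _ _ _
  · exact absurd rfl hkl

theorem eq_of_mem_edgeCells {T : ℕ → Set Plane} {c d : Set Plane} (hc : c ∈ edgeCells T)
    (hd : d ∈ edgeCells T) {x : Plane} (hxc : x ∈ c) (hxd : x ∈ d) : c = d := by
  obtain ⟨i, j, hij, u, hu, rfl⟩ := hc
  obtain ⟨k, l, hkl, w, hw, rfl⟩ := hd
  have h := commonPoints_eq_of_mem hij hkl (connectedComponentIn_subset _ _ hxc)
    (connectedComponentIn_subset _ _ hxd)
  rw [h] at hxc ⊢
  exact (connectedComponentIn_eq hxc).trans (connectedComponentIn_eq hxd).symm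

/-- The cells are pairwise disjoint, so that they partition the plane. -/
theorem eq_of_mem_of_mem {c d : 𝒯.DigitalVersion} {x : Plane} (hc : x ∈ c.1) (hd : x ∈ d.1) :
    c = d := by
  have key : ∀ {i : ℕ} {d : Set Plane}, d ∈ edgeCells 𝒯.tile → x ∈ interior (𝒯.tile i) →
      x ∉ d := by
    rintro i _ ⟨k, l, hkl, w, hw, rfl⟩ hi hd
    have h := (connectedComponentIn_subset _ _ hd).1
    exact hkl ((eq_of_mem_interior_of_mem_tile hi h.1).symm.trans
      (eq_of_mem_interior_of_mem_tile hi h.2))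
  have key' : ∀ {d : Set Plane}, d ∈ edgeCells 𝒯.tile → x ∈ vertexPoints 𝒯.tile → x ∉ d := by
    rintro _ ⟨k, l, hkl, w, hw, rfl⟩ hv hd
    exact (connectedComponentIn_subset _ _ hd).2 hv
  obtain ⟨c, (⟨i, rfl⟩ | hce) | ⟨u, hu, rfl⟩⟩ := c <;>
    obtain ⟨d, (⟨j, rfl⟩ | hde) | ⟨v, hv, rfl⟩⟩ := d <;>
    refine Subtype.ext ?_ <;> dsimp only at hc hd ⊢
  · rw [eq_of_mem_interior_of_mem_tile hc (interior_subset hd)]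
  · exact absurd hd (key hde hc)
  · rw [mem_singleton_iff.1 hd] at hc
    exact absurd hv (notMem_vertexPoints_of_mem_interior hc)
  · exact absurd hc (key hce hd)
  · exact eq_of_mem_edgeCells hce hde hc hd
  · exact absurd hc (key' hce (mem_singleton_iff.1 hd ▸ hv))
  · rw [mem_singleton_iff.1 hc] at hd
    exact absurd hu (notMem_vertexPoints_of_mem_interior hd)
  · exact absurd hd (key' hde (mem_singleton_iff.1 hc ▸ hu))
  · rw [← mem_singleton_iff.1 hc, ← mem_singleton_iff.1 hd]

theorem mem_quotientMap (x : Plane) : x ∈ (𝒯.quotientMap x).1 :=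
  (𝒯.exists_cell x).choose_spec

/-- As a component of the set of non-vertex points of two tiles, an edge is closed in that set, so
that its limit points outside it are vertices. -/
theorem exists_closure_subset_of_mem_edgeCells {c : Set Plane} (hc : c ∈ edgeCells 𝒯.tile) :
    ∃ i j, i ≠ j ∧ closure c ⊆ 𝒯.tile i ∩ 𝒯.tile j ∧ closure c ⊆ c ∪ vertexPoints 𝒯.tile := by
  obtain ⟨i, j, hij, u, hu, rfl⟩ := hc
  have hT : closure (connectedComponentIn (commonPoints 𝒯.tile i j) u) ⊆
      𝒯.tile i ∩ 𝒯.tile j :=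
    closure_minimal ((connectedComponentIn_subset _ _).trans fun x hx => hx.1)
      ((𝒯.isClosed_tile i).inter (𝒯.isClosed_tile j))
  refine ⟨i, j, hij, hT, fun x hx => or_iff_not_imp_right.2 fun hxv => ?_⟩
  have hpre : IsPreconnected
      (insert x (connectedComponentIn (commonPoints 𝒯.tile i j) u)) :=
    isPreconnected_connectedComponentIn.subset_closure (subset_insert _ _)
      (insert_subset hx subset_closure)
  have hsub : insert x (connectedComponentIn (commonPoints 𝒯.tile i j) u) ⊆
      commonPoints 𝒯.tile i j := insert_subset ⟨hT hx, hxv⟩ (connectedComponentIn_subset _ _)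
  exact hpre.subset_connectedComponentIn (mem_insert_of_mem _ (mem_connectedComponentIn hu))
    hsub (mem_insert _ _)

theorem finite_vertexPoints_inter {i j : ℕ} (hij : i ≠ j) :
    (𝒯.tile i ∩ 𝒯.tile j ∩ vertexPoints 𝒯.tile).Finite := by
  rcases (𝒯.tile i ∩ 𝒯.tile j).eq_empty_or_nonempty with h | h
  · simp [h]
  obtain ⟨S, hS, hSc, -, hST⟩ := 𝒯.inter_eq_sUnion i j hij h
  refine (hS.preimage (f := fun u : Plane => ({u} : Set Plane))
    singleton_injective.injOn).subset ?_
  rintro u ⟨hu, huv⟩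
  rw [hST] at hu
  obtain ⟨s, hs, hus⟩ := hu
  rcases hSc hs with ⟨v, -, rfl⟩ | ⟨k, l, hkl, w, hw, rfl⟩
  · rw [mem_singleton_iff.1 hus]; exact hs
  · exact absurd huv (connectedComponentIn_subset _ _ hus).2

/-- The closure of a cell is a union of cells. -/
theorem subset_closure_of_inter_nonempty {c d : 𝒯.DigitalVersion}
    (h : (d.1 ∩ closure c.1).Nonempty) : d.1 ⊆ closure c.1 := by
  obtain ⟨x, hxd, hxc⟩ := h
  by_cases hx : x ∈ c.1
  · rw [eq_of_mem_of_mem hxd hx]; exact subset_closure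
  by_cases hxv : x ∈ vertexPoints 𝒯.tile
  · rw [eq_of_mem_of_mem (d := ⟨{x}, Or.inr ⟨x, hxv, rfl⟩⟩) hxd rfl]
    simpa using hxc
  obtain ⟨c, (⟨i, rfl⟩ | hce) | ⟨u, hu, rfl⟩⟩ := c <;> dsimp only at hxc hx ⊢
  · rw [closure_interior_tile] at hxc ⊢
    obtain ⟨d, (⟨j, rfl⟩ | ⟨j, k, hjk, w, hw, rfl⟩) | ⟨v, hv, rfl⟩⟩ := d <;> dsimp only at hxd ⊢
    · rw [eq_of_mem_interior_of_mem_tile hxd hxc]; exact interior_subset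
    · intro y hy
      have hy' := (connectedComponentIn_subset _ _ hy).1
      rcases eq_or_eq_of_mem_commonPoints hjk (connectedComponentIn_subset _ _ hxd) hxc with
        rfl | rfl
      exacts [hy'.1, hy'.2]
    · exact absurd (mem_singleton_iff.1 hxd ▸ hv) hxv
  · obtain ⟨i, j, -, -, hcl⟩ := exists_closure_subset_of_mem_edgeCells hce
    exact absurd (hcl hxc) (not_or.2 ⟨hx, hxv⟩)
  · exact absurd (by simpa using hxc) hx

/-- In the digital version, the cells contained in the closure of a cell form a closed set. -/
theorem isClosed_subset_closure (c : 𝒯.DigitalVersion) :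
    IsClosed {d : 𝒯.DigitalVersion | d.1 ⊆ closure c.1} := by
  rw [isClosed_coinduced]
  have : 𝒯.quotientMap ⁻¹' {d : 𝒯.DigitalVersion | d.1 ⊆ closure c.1} = closure c.1 := by
    ext x
    exact ⟨fun h => h (mem_quotientMap x),
      fun h => subset_closure_of_inter_nonempty ⟨x, mem_quotientMap x, h⟩⟩
  rw [this]
  exact isClosed_closure

/-- Adjacency in the connectedness graph is incidence of cells. -/
theorem subset_closure_or_subset_closure_of_isPreconnected {c d : 𝒯.DigitalVersion}
    (h : IsPreconnected ({c, d} : Set 𝒯.DigitalVersion)) :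
    d.1 ⊆ closure c.1 ∨ c.1 ⊆ closure d.1 := by
  by_contra! hcon
  obtain ⟨z, rfl | rfl, hz1, hz2⟩ := h _ _ (isClosed_subset_closure c).isOpen_compl
    (isClosed_subset_closure d).isOpen_compl
    (by
      rintro z (rfl | rfl)
      exacts [Or.inr hcon.2, Or.inl hcon.1])
    ⟨d, by simp, hcon.1⟩ ⟨c, by simp, hcon.2⟩
  exacts [hz1 subset_closure, hz2 subset_closure]

theorem exists_isSpokeSystem_cell (c : 𝒯.DigitalVersion) : ∃ p γ, IsSpokeSystem c.1 p γ := by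
  obtain ⟨c, (⟨i, rfl⟩ | hc) | ⟨u, -, rfl⟩⟩ := c
  · obtain ⟨g, hg, hinj, hgT⟩ := 𝒯.exists_parametrization_tile i
    simpa only [hgT] using exists_isSpokeSystem_interior hg hinj
  · obtain ⟨e⟩ := 𝒯.edge_homeomorph_interval c hc
    obtain ⟨i, j, hij, hT, hcl⟩ := exists_closure_subset_of_mem_edgeCells hc
    exact exists_isSpokeSystem_of_homeomorph_Ioo e
      ((𝒯.isCompact_tile i).of_isClosed_subset isClosed_closure (hT.trans inter_subset_left))
      ((finite_vertexPoints_inter hij).subset fun x hx =>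
        ⟨hT hx.1, (hcl hx.1).resolve_left hx.2⟩)
  · exact ⟨u, fun _ _ => u, isSpokeSystem_singleton u _⟩

end PlaneTiling

theorem proposition3p5 (𝒯 : PlaneTiling) :
    IsPlanarGraph (connectednessGraph 𝒯.DigitalVersion) := by
  choose p γ hγ using fun c : 𝒯.DigitalVersion => PlaneTiling.exists_isSpokeSystem_cell c
  refine isPlanarGraph_of_isSpokeSystem (c := fun c : 𝒯.DigitalVersion => c.1)
    (fun c d hcd => Set.disjoint_left.2 fun x hc hd =>
      hcd (PlaneTiling.eq_of_mem_of_mem hc hd)) hγ fun c d hadj => ?_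
  exact (PlaneTiling.subset_closure_or_subset_closure_of_isPreconnected hadj.2.isPreconnected).imp
    (fun h => h (hγ d).hub_mem) (fun h => h (hγ c).hub_mem)
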